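/- Let $\theta>0$ be real and $n\ge 1$ an integer. Write $(x)_m=x(x+1)\cdots(x+m-1)$, $(x)_0=1$; put $\Theta(m)=(\theta)_m/m!$ for integers $m\ge 0$ and $\Theta(m)=0$ for integers $m<0$. Let $M_n=(m_{ij})_{1\le i,j\le n}$ be the real symmetric matrix with entries $$m_{ij}=\frac{\Theta(n-i-j)}{\big(ij\,\Theta(n-i)\Theta(n-j)\big)^{1/2}}-\Big(\frac{\Theta(n-i)}{i\,\Theta(n)}\Big)^{1/2}\Big(\frac{\Theta(n-j)}{j\,\Theta(n)}\Big)^{1/2},$$ and let $$\mu_r=\frac{(-1)^r(r-1)!}{(\theta)_r},\qquad 1\le r\le n.$$ For $0\le r\le n-1$ let $q_r(x)=Q_r(x-1;1,\theta-1,n)$, where $$Q_r(x;\alpha,\beta,n)={}_3F_2(-r,-x,r+\alpha+\beta+1;\alpha+1,-n+1;1)=\sum_{k=0}^{r}\frac{(-r)_k(-x)_k(r+\alpha+\beta+1)_k}{(\alpha+1)_k(-n+1)_k\,k!}$$ are the discrete Hahn polynomials, and let $\pi_r=\Big(\sum_{j=1}^n j\,q_r(j)^2\,\Theta(n-j)\Big)^{1/2}$.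 Then $\pi_r>0$ for $0\le r\le n-1$, and the vectors $\bar e_r=(e_{r1},\dots,e_{rn})$, $1\le r\le n$, with $$e_{rj}=\pi_{r-1}^{-1}\,q_{r-1}(j)\,\sqrt{j\,\Theta(n-j)},\qquad 1\le j\le n,$$ form an orthonormal basis of $\mathbb R^n$. Moreover, for each $1\le r\le n$ the vector $\bar e_r$ is an eigenvector of $M_n$ corresponding to the eigenvalue $\mu_r$. -/

import Mathlib

open scoped Nat

noncomputable section

namespace Ewens

/-- The increasing factorial `(x)_m = x (x+1) ⋯ (x+m-1)`. -/
def rising (x : ℝ) (m : ℕ) : ℝ := (ascPochhammer ℝ m).eval x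

/-- `Θ(m) = (θ)_m / m!` for an integer `m ≥ 0`, and `Θ(m) = 0` for `m < 0`. -/
def Theta (θ : ℝ) (m : ℤ) : ℝ :=
  if 0 ≤ m then rising θ m.toNat / (m.toNat ! : ℝ) else 0

/-- The terminating hypergeometric polynomial
`F(-m, -x, (a); (b); z) = ∑_{k=0}^m (-m)_k (-x)_k ∏ (a_i)_k / (∏ (b_i)_k k!) z^k`. -/
def hypF (m : ℕ) (x : ℝ) (a b : List ℝ) (z : ℝ) : ℝ :=
  ∑ k ∈ Finset.range (m + 1),
    rising (-(m : ℝ)) k * rising (-x) k * (a.map fun c => rising c k).prod /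
      ((b.map fun c => rising c k).prod * (k ! : ℝ)) * z ^ k

/-- The discrete Hahn polynomial
`Q_r(x; α, β, n) = ₃F₂(-r, -x, r + α + β + 1; α + 1, -n + 1; 1)`. -/
def hahnQ (r : ℕ) (x α β : ℝ) (n : ℕ) : ℝ :=
  hypF r x [(r : ℝ) + α + β + 1] [α + 1, -(n : ℝ) + 1] 1

/-- `q_r(x) = Q_r(x - 1; 1, θ - 1, n)`. -/
def q (θ : ℝ) (n r : ℕ) (x : ℝ) : ℝ := hahnQ r (x - 1) 1 (θ - 1) n

/-- The bilinear form `⟨f, g⟩ = ∑_{j=1}^n j f(j) g(j) Θ(n-j)`. -/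
def form (θ : ℝ) (n : ℕ) (f g : ℝ → ℝ) : ℝ :=
  ∑ j ∈ Finset.Icc 1 n, (j : ℝ) * f j * g j * Theta θ ((n : ℤ) - (j : ℤ))

/-- The norm `π_r = ⟨q_r, q_r⟩^{1/2}`. -/
def normQ (θ : ℝ) (n r : ℕ) : ℝ := Real.sqrt (form θ n (q θ n r) (q θ n r))

/-- The entry `m_{ij}` of the matrix `M_n`, for `1 ≤ i, j ≤ n`. -/
def mEntry (θ : ℝ) (n i j : ℕ) : ℝ :=
  Theta θ ((n : ℤ) - i - j) /
      Real.sqrt ((i : ℝ) * (j : ℝ) * Theta θ ((n : ℤ) - i) * Theta θ ((n : ℤ) - j)) -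
    Real.sqrt (Theta θ ((n : ℤ) - i) / ((i : ℝ) * Theta θ n)) *
      Real.sqrt (Theta θ ((n : ℤ) - j) / ((j : ℝ) * Theta θ n))

/-- The matrix `M_n`. The index `i : Fin n` stands for the number `i + 1 ∈ {1, …, n}`. -/
def M (θ : ℝ) (n : ℕ) : Matrix (Fin n) (Fin n) ℝ :=
  Matrix.of fun i j => mEntry θ n ((i : ℕ) + 1) ((j : ℕ) + 1)

/-- `μ_r = (-1)^r (r-1)! / (θ)_r`, used for `r ≥ 1`. -/
def mu (θ : ℝ) (r : ℕ) : ℝ := (-1) ^ r * ((r - 1)! : ℝ) / rising θ r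

/-- The coordinate `e_{rj} = π_{r-1}⁻¹ q_{r-1}(j) √(j Θ(n-j))`, for `1 ≤ r, j ≤ n`. -/
def eEntry (θ : ℝ) (n r j : ℕ) : ℝ :=
  (normQ θ n (r - 1))⁻¹ * q θ n (r - 1) j * Real.sqrt ((j : ℝ) * Theta θ ((n : ℤ) - j))

/-- The vector `e_r = (e_{r1}, …, e_{rn})`, with coordinate `j : Fin n` standing for `j + 1`. -/
def eVec (θ : ℝ) (n r : ℕ) : EuclideanSpace ℝ (Fin n) :=
  WithLp.toLp 2 fun j => eEntry θ n r ((j : ℕ) + 1)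

end Ewens

end

namespace Ewens

open Finset Polynomial

/-! Put w(j) = j Θ(n-j), D = diag(w) and K(i,j) = Θ(n-i-j) - Θ(n-i) Θ(n-j) / Θ(n). Then M = D^{-1/2}
K D^{-1/2}, so the eigenvector claim becomes K q_r = μ_{r+1} D q_r for 0 ≤ r < n.

By Chu–Vandermonde, summing (j)_k against Θ(m-j) gives Θ(m) times a polynomial in m of degree k+1
(`sum_Theta_mul_rising`). The difference of its values at n-i and n is i times a polynomial in i
with leading term μ_{k+1} i^k. Hence D⁻¹K is triangular on polynomials filtered by degree
(`exists_sum_kernel_mul_rising`). It is also self-adjoint for `form`, so the orthogonal polynomials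
for w are its eigenvectors (`sum_kernel_mul_q`); distinctness of the μ_r plays no role.

That the q_r are these orthogonal polynomials (`form_q_eval_eq_zero`) comes down to the vanishing of
the r-th difference of a polynomial of degree less than r. -/

/-! ### Rising factorials and the Chu–Vandermonde identity -/

theorem rising_zero (x : ℝ) : rising x 0 = 1 := by simp [rising]

theorem rising_succ (x : ℝ) (m : ℕ) : rising x (m + 1) = rising x m * (x + m) := by
  simp [rising, ascPochhammer_succ_eval]

theorem rising_add (x : ℝ) (a b : ℕ) : rising x (a + b) = rising x a * rising (x + a) b := by
  induction b with
  | zero => simp [rising_zero]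
  | succ b ih => rw [← add_assoc, rising_succ, ih, rising_succ]; push_cast; ring

theorem rising_pos {x : ℝ} (hx : 0 < x) (m : ℕ) : 0 < rising x m := ascPochhammer_pos m x hx

theorem rising_one (m : ℕ) : rising 1 m = m ! := by
  induction m with
  | zero => simp [rising_zero]
  | succ m ih => rw [rising_succ, ih, Nat.factorial_succ]; push_cast; ring

theorem factorial_mul_rising (a k : ℕ) : (a ! : ℝ) * rising (a + 1) k = (a + k)! := by
  rw [← rising_one, ← rising_one, rising_add, add_comm (1 : ℝ)]

theorem rising_neg_mul_factorial {k N : ℕ} (h : k ≤ N) :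
    (-1) ^ k * rising (-(N : ℝ)) k * ((N - k)! : ℝ) = N ! := by
  induction k with
  | zero => simp [rising_zero]
  | succ k ih =>
    rw [← ih (by omega), rising_succ]
    obtain ⟨M, rfl⟩ := Nat.exists_eq_add_of_le h
    rw [show k + 1 + M - (k + 1) = M by omega, show k + 1 + M - k = M + 1 by omega,
      Nat.factorial_succ]
    push_cast
    ring

theorem rising_neg_eq_zero {a k : ℕ} (h : a < k) : rising (-(a : ℝ)) k = 0 := by
  obtain ⟨d, rfl⟩ := Nat.exists_eq_add_of_lt h
  rw [add_assoc, rising_add, add_comm d, rising_add]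
  simp [rising]

/-- The Chu–Vandermonde convolution identity for `(x)_m / m!`. -/
theorem sum_rising_div_factorial_mul (x y : ℝ) (m : ℕ) :
    ∑ p ∈ antidiagonal m, rising x p.1 / p.1 ! * (rising y p.2 / p.2 !) =
      rising (x + y) m / m ! := by
  have hs : ∀ (z : ℝ) (a : ℕ), ((a : ℝ) + 1) * (rising z (a + 1) / (a + 1)!) =
      (z + a) * (rising z a / a !) := by
    intro z a
    have : (a ! : ℝ) ≠ 0 := by positivity
    have : (a : ℝ) + 1 ≠ 0 := by positivity
    rw [rising_succ, Nat.factorial_succ]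
    push_cast
    field_simp
  induction m with
  | zero => simp [rising_zero]
  | succ m ih =>
    -- Multiplying the sum by m+1 = p.1 + p.2 splits it in two; in each part the index factor lowers
    -- one index by one.
    have h1 : ∑ p ∈ antidiagonal (m + 1),
        (p.1 : ℝ) * (rising x p.1 / p.1 ! * (rising y p.2 / p.2 !)) =
        ∑ p ∈ antidiagonal m, (x + p.1) * (rising x p.1 / p.1 ! * (rising y p.2 / p.2 !)) := by
      rw [Nat.sum_antidiagonal_succ]
      simp only [Nat.cast_zero, zero_mul, zero_add]
      refine sum_congr rfl fun p _ => ?_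
      rw [← mul_assoc, ← mul_assoc, ← hs]
      push_cast
      ring
    have h2 : ∑ p ∈ antidiagonal (m + 1),
        (p.2 : ℝ) * (rising x p.1 / p.1 ! * (rising y p.2 / p.2 !)) =
        ∑ p ∈ antidiagonal m, (y + p.2) * (rising x p.1 / p.1 ! * (rising y p.2 / p.2 !)) := by
      rw [Nat.sum_antidiagonal_succ']
      simp only [Nat.cast_zero, zero_mul, zero_add]
      refine sum_congr rfl fun p _ => ?_
      rw [mul_left_comm, mul_left_comm (y + _), ← hs]
      push_cast
      ring
    have hm : (m : ℝ) + 1 ≠ 0 := by positivity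
    refine mul_left_cancel₀ hm ?_
    rw [hs, ← ih, mul_sum, mul_sum]
    trans ∑ p ∈ antidiagonal (m + 1),
        ((p.1 : ℝ) * (rising x p.1 / p.1 ! * (rising y p.2 / p.2 !)) +
          (p.2 : ℝ) * (rising x p.1 / p.1 ! * (rising y p.2 / p.2 !)))
    · refine sum_congr rfl fun p hp => ?_
      rw [← add_mul]
      congr 1
      exact_mod_cast (mem_antidiagonal.1 hp).symm
    · rw [sum_add_distrib, h1, h2, ← sum_add_distrib]
      refine sum_congr rfl fun p hp => ?_
      rw [← mem_antidiagonal.1 hp]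
      push_cast
      ring

theorem sum_range_rising_div_factorial_mul (x y : ℝ) (m : ℕ) :
    ∑ a ∈ range (m + 1), rising x a / a ! * (rising y (m - a) / (m - a)!) =
      rising (x + y) m / m ! := by
  rw [← sum_rising_div_factorial_mul,
    Nat.sum_antidiagonal_eq_sum_range_succ (fun a b => rising x a / a ! * (rising y b / b !))]

/-! ### The numbers Θ(m), and induction on degree -/

theorem Theta_natCast (θ : ℝ) (m : ℕ) : Theta θ m = rising θ m / m ! := by simp [Theta]

theorem Theta_pos {θ : ℝ} (hθ : 0 < θ) (m : ℕ) : 0 < Theta θ m := by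
  rw [Theta_natCast]
  have := rising_pos hθ m
  positivity

theorem Theta_sub_pos {θ : ℝ} (hθ : 0 < θ) {n j : ℕ} (h : j ≤ n) :
    0 < Theta θ ((n : ℤ) - j) := by
  rw [← Nat.cast_sub h]
  exact Theta_pos hθ _

/-- A sum against `Θ(m - j)` only sees the indices `1 ≤ j ≤ m`. -/
theorem sum_Icc_Theta_sub_mul (θ : ℝ) {m n : ℕ} (h : m ≤ n) (f : ℕ → ℝ) :
    ∑ j ∈ Icc 1 n, Theta θ ((m : ℤ) - j) * f j =
      ∑ a ∈ range m, rising θ (m - 1 - a) / (m - 1 - a)! * f (a + 1) := by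
  have hI : Icc 1 n = (range n).image (· + 1) := by
    ext j
    simp only [mem_Icc, mem_image, mem_range]
    exact ⟨fun hj => ⟨j - 1, by omega, by omega⟩, by rintro ⟨a, ha, rfl⟩; omega⟩
  rw [hI, sum_image (by intro a _ b _ hab; exact Nat.succ_injective hab)]
  symm
  refine sum_subset_zero_on_sdiff (range_subset_range.2 h) ?_ ?_
  · intro a ha
    simp only [mem_sdiff, mem_range, not_lt] at ha
    rw [Theta, if_neg (by push_cast; omega), zero_mul]
  · intro a ha
    rw [mem_range] at ha
    rw [← Theta_natCast]
    congr 2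
    push_cast [show 1 ≤ m by omega, show a ≤ m - 1 by omega]
    ring

/-- A property of polynomials of degree less than `d` can be checked along a family containing
one polynomial of each degree. -/
theorem induction_on_degree_lt {b : ℕ → ℝ[X]} (hb : ∀ k, (b k).degree = k) {P : ℝ[X] → Prop}
    (h0 : P 0) (d : ℕ) (hadd : ∀ k < d, ∀ (f : ℝ[X]) (c : ℝ), f.degree < k → P f → P (f + C c * b k)) :
    ∀ f : ℝ[X], f.degree < d → P f := by
  induction d with
  | zero =>
    intro f hf
    have : f = 0 := by
      rw [← degree_eq_bot]
      simpa [Nat.WithBot.lt_zero_iff] using hf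
    rwa [this]
  | succ d ih =>
    intro f hf
    have hl : (b d).coeff d ≠ 0 := by
      have := coeff_natDegree (p := b d)
      rw [natDegree_eq_of_degree_eq_some (hb d)] at this
      rw [this, Ne, leadingCoeff_eq_zero, ← degree_eq_bot, hb d]
      simp
    have hg : (f - C (f.coeff d / (b d).coeff d) * b d).degree < d := by
      rw [degree_lt_iff_coeff_zero]
      intro m hm
      rw [coeff_sub, coeff_C_mul]
      rcases hm.eq_or_lt with rfl | hm
      · field_simp; ring
      · rw [coeff_eq_zero_of_degree_lt (p := f) (n := m) (lt_of_lt_of_le hf (by exact_mod_cast hm)),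
          coeff_eq_zero_of_degree_lt (p := b d) (n := m) (by rw [hb d]; exact_mod_cast hm)]
        ring
    have := hadd d d.lt_succ_self _ (f.coeff d / (b d).coeff d) hg
      (ih (fun k hk => hadd k (by omega)) _ hg)
    simpa using this

/-! ### The kernel, the weight and triangularity -/

/-- The entry `Θ(n-i-j) - Θ(n-i) Θ(n-j) / Θ(n)` of the matrix `M_n` before it is scaled. -/
noncomputable def kernel (θ : ℝ) (n i j : ℕ) : ℝ :=
  Theta θ ((n : ℤ) - i - j) - Theta θ ((n : ℤ) - i) * Theta θ ((n : ℤ) - j) / Theta θ n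

/-- The weight `j Θ(n-j)`. -/
noncomputable def weight (θ : ℝ) (n j : ℕ) : ℝ := j * Theta θ ((n : ℤ) - j)

theorem kernel_symm (θ : ℝ) (n i j : ℕ) : kernel θ n i j = kernel θ n j i := by
  rw [kernel, kernel, sub_right_comm, mul_comm (Theta θ ((n : ℤ) - i))]

theorem weight_pos {θ : ℝ} (hθ : 0 < θ) {n j : ℕ} (hj : j ∈ Icc 1 n) : 0 < weight θ n j := by
  rw [mem_Icc] at hj
  have : 0 < (j : ℝ) := by exact_mod_cast hj.1
  exact mul_pos this (Theta_sub_pos hθ hj.2)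

theorem form_eq_sum_weight (θ : ℝ) (n : ℕ) (f g : ℝ → ℝ) :
    form θ n f g = ∑ j ∈ Icc 1 n, weight θ n j * (f j * g j) :=
  sum_congr rfl fun j _ => by rw [weight]; ring

theorem form_comm (θ : ℝ) (n : ℕ) (f g : ℝ → ℝ) : form θ n f g = form θ n g f := by
  simp only [form_eq_sum_weight, mul_comm]

theorem form_add_mul_right (θ : ℝ) (n : ℕ) (f g h : ℝ → ℝ) (c : ℝ) :
    form θ n f (fun x => g x + c * h x) = form θ n f g + c * form θ n f h := by
  simp only [form_eq_sum_weight, mul_sum, ← sum_add_distrib]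
  exact sum_congr rfl fun j _ => by ring

/-- The polynomial `k! x (θ+x)_k / (θ)_{k+1}`. -/
noncomputable def convPoly (θ : ℝ) (k : ℕ) : ℝ[X] :=
  C (k ! / rising θ (k + 1)) * X * (ascPochhammer ℝ k).comp (X + C θ)

/-- Since (a+1)_k = k! (k+1)_a / a!, the sum is a Chu–Vandermonde convolution with parameters k+1
and θ. -/
theorem sum_Theta_mul_rising {θ : ℝ} (hθ : 0 < θ) (k : ℕ) {m n : ℕ} (h : m ≤ n) :
    ∑ j ∈ Icc 1 n, Theta θ ((m : ℤ) - j) * rising j k =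
      Theta θ m * (convPoly θ k).eval (m : ℝ) := by
  rw [sum_Icc_Theta_sub_mul θ h (fun j => rising j k)]
  rcases m with _ | m
  · simp [convPoly]
  have hr : ∀ a : ℕ, rising ((a + 1 : ℕ) : ℝ) k = k ! * (rising (k + 1) a / a !) := by
    intro a
    have h1 := factorial_mul_rising a k
    have h2 := factorial_mul_rising k a
    have : (a ! : ℝ) ≠ 0 := by positivity
    rw [add_comm k a, ← h1] at h2
    push_cast
    field_simp
    linarith
  simp only [hr, Nat.add_sub_cancel]
  have h1 := sum_range_rising_div_factorial_mul ((k : ℝ) + 1) θ m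
  trans k ! * ∑ a ∈ range (m + 1), rising ((k : ℝ) + 1) a / a ! * (rising θ (m - a) / (m - a)!)
  · rw [mul_sum]
    exact sum_congr rfl fun a _ => by ring
  rw [h1, Theta_natCast]
  -- Both sides are (θ)_{m+k+1}, split after m+1 or after k+1 factors.
  have h2 : rising θ (m + 1) * rising (θ + (m + 1 : ℕ)) k =
      rising θ (k + 1) * rising (k + 1 + θ) m := by
    rw [← rising_add, show (k : ℝ) + 1 + θ = θ + (k + 1 : ℕ) by push_cast; ring, ← rising_add]
    congr 1
    ring
  have h3 : (convPoly θ k).eval ((m + 1 : ℕ) : ℝ) =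
      k ! / rising θ (k + 1) * (m + 1 : ℕ) * rising (θ + (m + 1 : ℕ)) k := by
    simp [convPoly, rising, add_comm]
  have := (rising_pos hθ (k + 1)).ne'
  have : (m ! : ℝ) ≠ 0 := by positivity
  rw [h3, Nat.factorial_succ]
  push_cast at h2 ⊢
  field_simp
  linear_combination -h2

theorem natDegree_convPoly {θ : ℝ} (hθ : 0 < θ) (k : ℕ) :
    (convPoly θ k).natDegree = k + 1 ∧
      (convPoly θ k).leadingCoeff = k ! / rising θ (k + 1) := by
  have hc : (k ! / rising θ (k + 1) : ℝ) ≠ 0 :=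
    div_ne_zero (by positivity) (rising_pos hθ _).ne'
  have hm : ((ascPochhammer ℝ k).comp (X + C θ)).Monic :=
    (monic_ascPochhammer ℝ k).comp_X_add_C θ
  have hd : ((ascPochhammer ℝ k).comp (X + C θ)).natDegree = k := by
    rw [natDegree_comp, natDegree_X_add_C, mul_one, ascPochhammer_natDegree]
  constructor
  · rw [convPoly, natDegree_mul (mul_ne_zero (C_ne_zero.2 hc) X_ne_zero) hm.ne_zero, hd,
      natDegree_C_mul_X _ hc, add_comm]
  · rw [convPoly, leadingCoeff_mul, hm.leadingCoeff, mul_one, leadingCoeff_mul, leadingCoeff_C,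
      leadingCoeff_X, mul_one]

/-- The difference vanishes at x = 0, hence the factor x. Reflection multiplies the leading
coefficient k!/(θ)_{k+1} by (-1)^{k+1}, which produces μ_{k+1}. -/
theorem exists_reflect_convPoly {θ : ℝ} (hθ : 0 < θ) (n k : ℕ) :
    ∃ h : ℝ[X], h.degree < k ∧ ∀ x : ℝ,
      (convPoly θ k).eval (n - x) - (convPoly θ k).eval (n : ℝ) =
        x * (mu θ (k + 1) * rising x k + h.eval x) := by
  obtain ⟨hd, hl⟩ := natDegree_convPoly hθ k
  set R := convPoly θ k
  have hlin : (C (n : ℝ) - X).natDegree = 1 := by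
    rw [← natDegree_neg, neg_sub, natDegree_X_sub_C]
  have hlinc : (C (n : ℝ) - X).leadingCoeff = -1 := by
    rw [← neg_sub, leadingCoeff_neg, leadingCoeff_X_sub_C]
  set H := R.comp (C (n : ℝ) - X) - C (R.eval (n : ℝ)) with hH
  have hRd : (R.comp (C (n : ℝ) - X)).natDegree = k + 1 := by
    rw [natDegree_comp, hlin, hd, mul_one]
  have hHc : H.coeff (k + 1) = mu θ (k + 1) := by
    rw [hH, coeff_sub, coeff_C_of_ne_zero (by omega), sub_zero, ← hRd, coeff_natDegree,
      leadingCoeff_comp (by rw [hlin]; exact one_ne_zero), hlinc, hl, hd, hRd, mu,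
      Nat.add_sub_cancel]
    ring
  have hHd : ∀ m, k + 1 < m → H.coeff m = 0 := by
    intro m hm
    rw [hH, coeff_sub, coeff_C_of_ne_zero (by omega), sub_zero,
      coeff_eq_zero_of_natDegree_lt (by omega)]
  have hH0 : H.coeff 0 = 0 := by
    rw [coeff_zero_eq_eval_zero, hH]
    simp
  have hX : H.divX * X = H := by
    have := divX_mul_X_add H
    rwa [hH0, C_0, add_zero] at this
  refine ⟨H.divX - C (mu θ (k + 1)) * ascPochhammer ℝ k, ?_, fun x => ?_⟩
  · rw [degree_lt_iff_coeff_zero]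
    intro m hm
    rw [coeff_sub, coeff_divX, coeff_C_mul]
    rcases hm.eq_or_lt with rfl | hm
    · have := (monic_ascPochhammer ℝ k).coeff_natDegree
      rw [ascPochhammer_natDegree] at this
      rw [this, hHc]
      ring
    · rw [hHd _ (by omega), coeff_eq_zero_of_natDegree_lt (by rwa [ascPochhammer_natDegree])]
      ring
  · have h1 : H.eval x = R.eval (n - x) - R.eval (n : ℝ) := by simp [hH]
    have h2 : H.eval x = x * H.divX.eval x := by
      conv_lhs => rw [← hX]
      rw [eval_mul, eval_X, mul_comm]
    rw [← h1, h2]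
    simp [rising]

/-- The operator with kernel `K` preserves, up to the weight, polynomials of bounded degree, and it
is triangular with diagonal entries `μ_{k+1}`. -/
theorem exists_sum_kernel_mul_rising {θ : ℝ} (hθ : 0 < θ) (n k : ℕ) :
    ∃ h : ℝ[X], h.degree < k ∧ ∀ i ∈ Icc 1 n,
      ∑ j ∈ Icc 1 n, kernel θ n i j * rising j k =
        weight θ n i * (mu θ (k + 1) * rising i k + h.eval (i : ℝ)) := by
  obtain ⟨h, hdeg, hh⟩ := exists_reflect_convPoly hθ n k
  refine ⟨h, hdeg, fun i hi => ?_⟩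
  rw [mem_Icc] at hi
  have h1 := sum_Theta_mul_rising hθ k (Nat.sub_le n i)
  have h2 := sum_Theta_mul_rising hθ k (le_refl n)
  rw [Nat.cast_sub hi.2, Nat.cast_sub hi.2] at h1
  have h3 := (Theta_pos hθ n).ne'
  -- The two terms of the kernel are the convolution sums for m = n-i and m = n.
  trans ∑ j ∈ Icc 1 n, Theta θ ((n : ℤ) - i - j) * rising j k -
    Theta θ ((n : ℤ) - i) / Theta θ n * ∑ j ∈ Icc 1 n, Theta θ ((n : ℤ) - j) * rising j k
  · rw [mul_sum, ← sum_sub_distrib]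
    exact sum_congr rfl fun j _ => by rw [kernel]; ring
  · rw [h1, h2, weight, mul_assoc (i : ℝ), mul_left_comm (i : ℝ), ← hh]
    field_simp

theorem degree_ascPochhammer (k : ℕ) : (ascPochhammer ℝ k).degree = k := by
  rw [degree_eq_natDegree (monic_ascPochhammer ℝ k).ne_zero, ascPochhammer_natDegree]

theorem exists_sum_kernel_mul_eval {θ : ℝ} (hθ : 0 < θ) (n d : ℕ) (f : ℝ[X])
    (hf : f.degree < d) :
    ∃ g : ℝ[X], g.degree < d ∧ ∀ i ∈ Icc 1 n,
      ∑ j ∈ Icc 1 n, kernel θ n i j * f.eval (j : ℝ) = weight θ n i * g.eval (i : ℝ) := by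
  refine induction_on_degree_lt degree_ascPochhammer (P := fun f => ∃ g : ℝ[X], g.degree < d ∧
    ∀ i ∈ Icc 1 n, ∑ j ∈ Icc 1 n, kernel θ n i j * f.eval (j : ℝ) =
      weight θ n i * g.eval (i : ℝ)) ⟨0, by simp, by simp⟩ d ?_ f hf
  rintro k hk f c - ⟨g, hg, hgs⟩
  obtain ⟨h, hh, hhs⟩ := exists_sum_kernel_mul_rising hθ n k
  have hk' : (k : WithBot ℕ) < d := by exact_mod_cast hk
  refine ⟨g + C c * (C (mu θ (k + 1)) * ascPochhammer ℝ k + h), ?_, fun i hi => ?_⟩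
  · rw [← mem_degreeLT] at *
    rw [C_mul', C_mul']
    refine add_mem hg (Submodule.smul_mem _ _ (add_mem (Submodule.smul_mem _ _ ?_) ?_))
    · rwa [mem_degreeLT, degree_ascPochhammer]
    · exact mem_degreeLT.2 ((mem_degreeLT.1 hh).trans hk')
  · have := hhs i hi
    simp only [eval_add, eval_mul, eval_C, mul_add, sum_add_distrib, hgs i hi]
    simp only [rising, mul_left_comm _ c, ← mul_sum] at this ⊢
    rw [this]
    ring

/-- The top coefficient gets multiplied by `μ_{k+1}`. -/
theorem exists_sum_kernel_mul_eval_sub {θ : ℝ} (hθ : 0 < θ) (n k : ℕ) (f : ℝ[X])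
    (hf : f.degree < (k + 1 : ℕ)) :
    ∃ g : ℝ[X], g.degree < k ∧ ∀ i ∈ Icc 1 n,
      ∑ j ∈ Icc 1 n, kernel θ n i j * f.eval (j : ℝ) =
        weight θ n i * (mu θ (k + 1) * f.eval (i : ℝ) + g.eval (i : ℝ)) := by
  obtain ⟨h, hh, hhs⟩ := exists_sum_kernel_mul_rising hθ n k
  set c := f.coeff k
  set e := f - C c * ascPochhammer ℝ k with he
  have hed : e.degree < k := by
    rw [degree_lt_iff_coeff_zero]
    intro m hm
    rw [he, coeff_sub, coeff_C_mul]
    rcases hm.eq_or_lt with rfl | hm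
    · have := (monic_ascPochhammer ℝ k).coeff_natDegree
      rw [ascPochhammer_natDegree] at this
      rw [this]
      ring
    · rw [coeff_eq_zero_of_natDegree_lt (p := ascPochhammer ℝ k) (by rwa [ascPochhammer_natDegree]),
        coeff_eq_zero_of_degree_lt (lt_of_lt_of_le hf (by exact_mod_cast hm))]
      ring
  obtain ⟨g, hg, hgs⟩ := exists_sum_kernel_mul_eval hθ n k e hed
  refine ⟨g + C c * h - C (mu θ (k + 1)) * e, ?_, fun i hi => ?_⟩
  · rw [← mem_degreeLT] at *
    rw [C_mul', C_mul']
    exact sub_mem (add_mem hg (Submodule.smul_mem _ _ hh)) (Submodule.smul_mem _ _ hed)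
  · have hfe : ∀ x, f.eval x = e.eval x + c * rising x k := by
      intro x
      simp [he, rising]
    simp only [hfe, mul_add, sum_add_distrib, hgs i hi, eval_add, eval_sub, eval_mul, eval_C]
    simp only [mul_left_comm _ c, ← mul_sum]
    rw [hhs i hi]
    ring

/-! ### Orthogonality of the Hahn polynomials -/

theorem rising_neg_div_factorial {k r : ℕ} (h : k ≤ r) :
    rising (-(r : ℝ)) k / k ! = (-1) ^ k * r.choose k := by
  have h1 := rising_neg_mul_factorial h
  rw [← Nat.choose_mul_factorial_mul_factorial h] at h1
  push_cast at h1
  have h2 : (-1 : ℝ) ^ k * (-1) ^ k = 1 := by rw [← mul_pow]; simp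
  have h3 : ((r - k)! : ℝ) ≠ 0 := by positivity
  have h4 : (k ! : ℝ) ≠ 0 := by positivity
  rw [div_eq_iff h4]
  refine mul_right_cancel₀ h3 ?_
  linear_combination (-1) ^ k * h1 - rising (-(r : ℝ)) k * ((r - k)! : ℝ) * h2

/-- Up to sign, this is the r-th forward difference of a polynomial of degree e < r. -/
theorem sum_rising_neg_mul_rising_eq_zero {e r : ℕ} (h : e < r) (y : ℝ) :
    ∑ k ∈ range (r + 1), rising (-(r : ℝ)) k / k ! * rising (y + k) e = 0 := by
  have h1 := congrFun (fwdDiff_iter_eq_zero_of_degree_lt (P := ascPochhammer ℝ e) (n := r)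
    (by rwa [ascPochhammer_natDegree])) y
  rw [fwdDiff_iter_eq_sum_shift, Pi.zero_apply] at h1
  rw [← mul_zero ((-1 : ℝ) ^ r), ← h1, mul_sum]
  refine sum_congr rfl fun k hk => ?_
  have hk : k ≤ r := by rw [mem_range] at hk; omega
  rw [rising_neg_div_factorial hk]
  obtain ⟨d, rfl⟩ := Nat.exists_eq_add_of_le hk
  have h2 : (-1 : ℝ) ^ d * (-1) ^ d = 1 := by rw [← mul_pow]; simp
  simp only [zsmul_eq_mul, nsmul_eq_mul, mul_one, Nat.add_sub_cancel_left, rising, pow_add]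
  push_cast
  linear_combination (-(-1 : ℝ) ^ k * ((k + d).choose k) * (ascPochhammer ℝ e).eval (y + k)) * h2

/-- Terms with a < k vanish. For a = k+c, (a+1)(-a)_k = (-1)^k (k+1)! (k+2)_c / c!, and
Chu–Vandermonde applies. -/
theorem sum_rising_neg_mul (y : ℝ) {k N : ℕ} (h : k ≤ N) :
    ∑ a ∈ range (N + 1), ((a : ℝ) + 1) * rising (-(a : ℝ)) k *
        (rising y (N - a) / (N - a)!) =
      (-1) ^ k * (k + 1)! * (rising (y + k + 2) (N - k) / (N - k)!) := by
  obtain ⟨M, rfl⟩ := Nat.exists_eq_add_of_le h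
  rw [add_assoc, sum_range_add, sum_eq_zero, zero_add, Nat.add_sub_cancel_left,
    show y + k + 2 = (k + 2) + y by ring, ← sum_range_rising_div_factorial_mul, mul_sum]
  · refine sum_congr rfl fun c _ => ?_
    have h1 := rising_neg_mul_factorial (Nat.le_add_right k c)
    rw [Nat.add_sub_cancel_left] at h1
    have h2 : (-1 : ℝ) ^ k * (-1) ^ k = 1 := by rw [← mul_pow]; simp
    have h3 := factorial_mul_rising (k + 1) c
    rw [show k + 1 + c = k + c + 1 by ring, Nat.factorial_succ (k + c)] at h3
    push_cast at h3
    rw [show (k : ℝ) + 1 + 1 = k + 2 by ring] at h3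
    rw [show k + M - (k + c) = M - c by omega, ← mul_assoc]
    congr 1
    have h4 : (c ! : ℝ) ≠ 0 := by positivity
    rw [← mul_div_assoc, eq_div_iff h4]
    push_cast at h1 ⊢
    linear_combination ((k : ℝ) + c + 1) * (-1) ^ k * h1 - (-1) ^ k * h3 -
      (((k : ℝ) + c + 1) * rising (-(k + c)) k * c !) * h2
  · intro a ha
    rw [rising_neg_eq_zero (mem_range.1 ha)]
    ring

/-- The coefficient of `(1-x)_k` in `q_r(x)`, for `n = N + 1`. -/
noncomputable def qCoeff (θ : ℝ) (N r k : ℕ) : ℝ :=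
  rising (-(r : ℝ)) k * rising (r + θ + 1) k / ((k + 1)! * rising (-(N : ℝ)) k * k !)

theorem rising_two (k : ℕ) : rising 2 k = (k + 1)! := by
  rw [← rising_one, add_comm k, rising_add, rising_one]
  norm_num

theorem q_eq_sum (θ : ℝ) (N r : ℕ) (x : ℝ) :
    q θ (N + 1) r x = ∑ k ∈ range (r + 1), qCoeff θ N r k * rising (1 - x) k := by
  unfold q hahnQ hypF
  refine sum_congr rfl fun k _ => ?_
  have h1 : (r : ℝ) + 1 + (θ - 1) + 1 = r + θ + 1 := by ring
  have h2 : -((N + 1 : ℕ) : ℝ) + 1 = -N := by push_cast; ring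
  rw [qCoeff, h1, h2, neg_sub, one_add_one_eq_two]
  simp only [List.map_cons, List.map_nil, List.prod_cons, List.prod_nil, rising_two]
  ring

/-- `q_r` as a polynomial, for `n = N + 1`. -/
noncomputable def qPoly (θ : ℝ) (N r : ℕ) : ℝ[X] :=
  ∑ k ∈ range (r + 1), C (qCoeff θ N r k) * (ascPochhammer ℝ k).comp (C 1 - X)

theorem eval_qPoly (θ : ℝ) (N r : ℕ) (x : ℝ) :
    (qPoly θ N r).eval x = q θ (N + 1) r x := by
  simp [qPoly, q_eq_sum, eval_finsetSum, rising]

theorem degree_ascPochhammer_comp (c : ℝ) (k : ℕ) :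
    ((ascPochhammer ℝ k).comp (C c - X)).degree = k := by
  have hlin : (C c - X).natDegree = 1 := by
    rw [← natDegree_neg, neg_sub, natDegree_X_sub_C]
  have hd : ((ascPochhammer ℝ k).comp (C c - X)).natDegree = k := by
    rw [natDegree_comp, hlin, mul_one, ascPochhammer_natDegree]
  have h0 : (ascPochhammer ℝ k).comp (C c - X) ≠ 0 := by
    rw [← leadingCoeff_ne_zero, leadingCoeff_comp (by rw [hlin]; exact one_ne_zero),
      (monic_ascPochhammer ℝ k).leadingCoeff, ← neg_sub, leadingCoeff_neg, leadingCoeff_X_sub_C]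
    simp
  rw [degree_eq_natDegree h0, hd]

theorem degree_qPoly_lt (θ : ℝ) (N r : ℕ) : (qPoly θ N r).degree < (r + 1 : ℕ) := by
  rw [← mem_degreeLT]
  refine sum_mem fun k hk => ?_
  rw [C_mul']
  refine Submodule.smul_mem _ _ ?_
  rw [mem_degreeLT, degree_ascPochhammer_comp]
  exact_mod_cast mem_range.1 hk

theorem q_one (θ : ℝ) (N r : ℕ) : q θ (N + 1) r 1 = 1 := by
  rw [q_eq_sum, sum_range_succ', sum_eq_zero, zero_add]
  · simp [qCoeff, rising_zero]
  · intro k _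
    have := rising_neg_eq_zero (Nat.succ_pos k)
    rw [Nat.cast_zero, neg_zero] at this
    rw [sub_self, this, mul_zero]

/-- These test polynomials merge with the weight: at x = a+1, (θ)_{N-a} (θ+N-a)_s = (θ)_s
(θ+s)_{N-a}, so the sum over a has a closed form. -/
theorem form_q_rising_eq_zero {θ : ℝ} (hθ : 0 < θ) {N r s : ℕ} (hr : r ≤ N) (hs : s < r) :
    form θ (N + 1) (q θ (N + 1) r) (fun x => rising (θ + (N + 1 : ℕ) - x) s) = 0 := by
  have h1 := sum_Icc_Theta_sub_mul θ (le_refl (N + 1)) (fun j : ℕ => (j : ℝ) *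
    q θ (N + 1) r j * rising (θ + (N + 1 : ℕ) - j) s)
  trans rising θ s * ∑ k ∈ range (r + 1), qCoeff θ N r k * ∑ a ∈ range (N + 1),
    ((a : ℝ) + 1) * rising (-(a : ℝ)) k * (rising (θ + s) (N - a) / (N - a)!)
  · trans ∑ j ∈ Icc 1 (N + 1), Theta θ (((N + 1 : ℕ) : ℤ) - j) * ((j : ℝ) *
      q θ (N + 1) r j * rising (θ + (N + 1 : ℕ) - j) s)
    · exact sum_congr rfl fun j _ => by ring
    rw [h1]
    simp only [mul_sum]
    rw [sum_comm]
    refine sum_congr rfl fun a ha => ?_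
    have ha : a ≤ N := by rw [mem_range] at ha; omega
    have h2 : rising θ (N - a) * rising (θ + (N + 1 : ℕ) - (a + 1 : ℕ)) s =
        rising θ s * rising (θ + s) (N - a) := by
      rw [← rising_add, add_comm s, rising_add]
      congr 2
      push_cast [ha]
      ring
    have h3 : (1 : ℝ) - (a + 1 : ℕ) = -a := by push_cast; ring
    rw [Nat.add_sub_cancel, q_eq_sum, h3]
    trans ((a : ℝ) + 1) * (∑ k ∈ range (r + 1), qCoeff θ N r k * rising (-a) k) *
      (rising θ s * rising (θ + s) (N - a)) / (N - a)!
    · rw [← h2]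
      push_cast
      ring
    · rw [mul_sum, sum_mul, sum_div]
      exact sum_congr rfl fun k _ => by ring
  · obtain ⟨e, rfl⟩ := Nat.exists_eq_add_of_lt hs
    -- With r = s+e+1, the Hahn parameter r+θ+1 equals y+e, and (y+e)_k (y)_e = (y)_k (y+k)_e. The
    -- last factor is a polynomial in k of degree e < r.
    set y : ℝ := θ + s + 2 with hy
    have hy0 : 0 < y := by positivity
    have hye := (rising_pos hy0 e).ne'
    have hz := sum_rising_neg_mul_rising_eq_zero (show e < s + e + 1 by omega) y
    rw [← mul_zero (rising θ s * (rising y N / (N ! * rising y e))), ← hz, mul_assoc]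
    congr 1
    rw [mul_sum]
    refine sum_congr rfl fun k hk => ?_
    have hk : k ≤ N := by rw [mem_range] at hk; omega
    rw [sum_rising_neg_mul _ hk, qCoeff]
    have hN := rising_neg_mul_factorial hk
    have h5 : rising (((s + e + 1 : ℕ) : ℝ) + θ + 1) k * rising y e =
        rising y k * rising (y + k) e := by
      rw [← rising_add, add_comm k, rising_add, mul_comm]
      congr 2
      rw [hy]
      push_cast
      ring
    have h6 : rising y k * rising (y + k) (N - k) = rising y N := by
      rw [← rising_add, Nat.add_sub_cancel' hk]
    rw [show θ + s + k + 2 = y + k by rw [hy]; ring, ← h6, ← hN]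
    have hN0 : (N ! : ℝ) ≠ 0 := by positivity
    have h7 : rising (-(N : ℝ)) k ≠ 0 := by
      intro h
      rw [h] at hN
      simp at hN
      exact hN0 hN.symm
    have h8 : (-1 : ℝ) ^ k * (-1) ^ k = 1 := by rw [← mul_pow]; simp
    have h9 : (-1 : ℝ) ^ k ≠ 0 := by simp
    field_simp
    rw [sq, h8, mul_one]
    linear_combination rising (-((s + e + 1 : ℕ) : ℝ)) k * rising (y + k) (N - k) * h5

theorem form_q_eval_eq_zero {θ : ℝ} (hθ : 0 < θ) {N r : ℕ} (hr : r ≤ N) (f : ℝ[X])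
    (hf : f.degree < r) : form θ (N + 1) (q θ (N + 1) r) (fun x => f.eval x) = 0 := by
  refine induction_on_degree_lt (degree_ascPochhammer_comp (θ + (N + 1 : ℕ)))
    (P := fun f => form θ (N + 1) (q θ (N + 1) r) (fun x => f.eval x) = 0)
    (by simp [form]) r ?_ f hf
  intro s hs f c _ h
  have h1 := form_q_rising_eq_zero hθ hr hs
  have h2 := form_add_mul_right θ (N + 1) (q θ (N + 1) r) (fun x => f.eval x)
    (fun x => rising (θ + (N + 1 : ℕ) - x) s) c
  rw [h, h1, mul_zero, add_zero] at h2
  rw [← h2]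
  congr 1
  ext x
  simp [rising]

theorem form_q_q_of_ne {θ : ℝ} (hθ : 0 < θ) {N r s : ℕ} (hr : r ≤ N) (hs : s ≤ N)
    (hrs : r ≠ s) : form θ (N + 1) (q θ (N + 1) r) (q θ (N + 1) s) = 0 := by
  have key : ∀ {r s : ℕ}, r ≤ N → s < r →
      form θ (N + 1) (q θ (N + 1) r) (q θ (N + 1) s) = 0 := by
    intro r s hr h
    have := form_q_eval_eq_zero hθ hr (qPoly θ N s)
      ((degree_qPoly_lt θ N s).trans_le (by exact_mod_cast h))
    simpa only [eval_qPoly] using this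
  rcases lt_or_gt_of_ne hrs with h | h
  · rw [form_comm]
    exact key hs h
  · exact key hr h

/-! ### Positivity of the norms and the eigenvalue equation -/

theorem form_self_nonneg {θ : ℝ} (hθ : 0 < θ) (n : ℕ) (f : ℝ → ℝ) : 0 ≤ form θ n f f := by
  rw [form_eq_sum_weight]
  exact sum_nonneg fun j hj => mul_nonneg (weight_pos hθ hj).le (mul_self_nonneg _)

theorem eq_zero_of_form_self_eq_zero {θ : ℝ} (hθ : 0 < θ) {n : ℕ} {f : ℝ → ℝ}
    (h : form θ n f f = 0) : ∀ j ∈ Icc 1 n, f j = 0 := by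
  rw [form_eq_sum_weight, sum_eq_zero_iff_of_nonneg
    fun j hj => mul_nonneg (weight_pos hθ hj).le (mul_self_nonneg _)] at h
  intro j hj
  simpa [(weight_pos hθ hj).ne'] using h j hj

theorem normQ_pos {θ : ℝ} (hθ : 0 < θ) (N r : ℕ) : 0 < normQ θ (N + 1) r := by
  refine Real.sqrt_pos.2 ((form_self_nonneg hθ _ _).lt_of_ne' fun h => ?_)
  have := eq_zero_of_form_self_eq_zero hθ h 1 (by simp)
  rw [Nat.cast_one, q_one] at this
  exact one_ne_zero this

/-- Write K q_r = w (μ_{r+1} q_r + g) with deg g < r. By symmetry of K, pairing with g gives ⟨q_r,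
g'⟩ for some g' of degree < r, which is 0. As ⟨q_r, g⟩ = 0 too, ⟨g, g⟩ = 0 and g vanishes at all
nodes. -/
theorem sum_kernel_mul_q {θ : ℝ} (hθ : 0 < θ) {N r : ℕ} (hr : r ≤ N) :
    ∀ i ∈ Icc 1 (N + 1), ∑ j ∈ Icc 1 (N + 1), kernel θ (N + 1) i j * q θ (N + 1) r j =
      weight θ (N + 1) i * (mu θ (r + 1) * q θ (N + 1) r i) := by
  obtain ⟨g, hg, hgs⟩ :=
    exists_sum_kernel_mul_eval_sub hθ (N + 1) r (qPoly θ N r) (degree_qPoly_lt θ N r)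
  simp only [eval_qPoly] at hgs
  obtain ⟨g', hg', hgs'⟩ := exists_sum_kernel_mul_eval hθ (N + 1) r g hg
  have h1 := form_q_eval_eq_zero hθ hr g hg
  have h2 := form_q_eval_eq_zero hθ hr g' hg'
  have h3 : form θ (N + 1) (fun x => g.eval x) (fun x => g.eval x) = 0 := by
    have h4 : ∑ i ∈ Icc 1 (N + 1), g.eval (i : ℝ) *
        ∑ j ∈ Icc 1 (N + 1), kernel θ (N + 1) i j * q θ (N + 1) r j =
        ∑ j ∈ Icc 1 (N + 1), q θ (N + 1) r j *
        ∑ i ∈ Icc 1 (N + 1), kernel θ (N + 1) j i * g.eval (i : ℝ) := by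
      simp only [mul_sum]
      rw [sum_comm]
      refine sum_congr rfl fun j _ => sum_congr rfl fun i _ => ?_
      rw [kernel_symm]
      ring
    have h5 : ∑ j ∈ Icc 1 (N + 1), q θ (N + 1) r j *
        ∑ i ∈ Icc 1 (N + 1), kernel θ (N + 1) j i * g.eval (i : ℝ) = 0 := by
      rw [← h2, form_eq_sum_weight]
      refine sum_congr rfl fun j hj => ?_
      rw [hgs' j hj]
      ring
    have h6 : ∑ i ∈ Icc 1 (N + 1), g.eval (i : ℝ) *
        ∑ j ∈ Icc 1 (N + 1), kernel θ (N + 1) i j * q θ (N + 1) r j =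
        mu θ (r + 1) * form θ (N + 1) (q θ (N + 1) r) (fun x => g.eval x) +
        form θ (N + 1) (fun x => g.eval x) (fun x => g.eval x) := by
      simp only [form_eq_sum_weight, mul_sum (Icc 1 (N + 1)) _ (mu θ (r + 1)),
        ← sum_add_distrib]
      refine sum_congr rfl fun i hi => ?_
      rw [hgs i hi]
      ring
    rw [h4, h5, h1] at h6
    linarith
  intro i hi
  rw [hgs i hi, eq_zero_of_form_self_eq_zero hθ h3 i hi, add_zero]

/-! ### Return to the matrix M and the vectors e_r -/

theorem eEntry_eq (θ : ℝ) (n r j : ℕ) :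
    eEntry θ n (r + 1) j = (normQ θ n r)⁻¹ * q θ n r j * √(weight θ n j) := rfl

theorem mEntry_eq {θ : ℝ} (hθ : 0 < θ) {n i j : ℕ} (hi : i ∈ Icc 1 n) (hj : j ∈ Icc 1 n) :
    mEntry θ n i j = kernel θ n i j / (√(weight θ n i) * √(weight θ n j)) := by
  have hwi := weight_pos hθ hi
  have hwj := weight_pos hθ hj
  rw [mem_Icc] at hi hj
  have hti := Theta_sub_pos hθ hi.2
  have htj := Theta_sub_pos hθ hj.2
  have htn := Theta_pos hθ n
  have hi0 : (0 : ℝ) < i := by exact_mod_cast hi.1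
  have hj0 : (0 : ℝ) < j := by exact_mod_cast hj.1
  have h1 : √((i : ℝ) * j * Theta θ ((n : ℤ) - i) * Theta θ ((n : ℤ) - j)) =
      √(weight θ n i) * √(weight θ n j) := by
    rw [← Real.sqrt_mul hwi.le]
    congr 1
    simp only [weight]
    ring
  have h2 : ∀ {k : ℕ}, (0 : ℝ) < k → 0 < Theta θ ((n : ℤ) - k) →
      √(Theta θ ((n : ℤ) - k) / (k * Theta θ n)) =
        Theta θ ((n : ℤ) - k) / (√(weight θ n k) * √(Theta θ n)) := by
    intro k hk ht
    have hw : 0 < weight θ n k := mul_pos hk ht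
    rw [← Real.sqrt_mul hw.le, Real.sqrt_eq_iff_mul_self_eq (by positivity) (by positivity),
      div_mul_div_comm, Real.mul_self_sqrt (by positivity), weight]
    field_simp
  rw [mEntry, h1, h2 hi0 hti, h2 hj0 htj, kernel]
  have h3 := Real.mul_self_sqrt htn.le
  have h4 := (Real.sqrt_pos.2 hwi).ne'
  have h5 := (Real.sqrt_pos.2 hwj).ne'
  have h6 := (Real.sqrt_pos.2 htn).ne'
  rw [div_mul_div_comm, show ∀ a b c : ℝ, a * c * (b * c) = a * b * (c * c) by intros; ring, h3]
  field_simp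

theorem sum_fin_succ (n : ℕ) (f : ℕ → ℝ) :
    ∑ j : Fin n, f ((j : ℕ) + 1) = ∑ j ∈ Icc 1 n, f j := by
  rw [Fin.sum_univ_eq_sum_range (fun j => f (j + 1)) n, range_eq_Ico,
    sum_Ico_add' f 0 n 1, zero_add]
  rfl

theorem inner_eVec (θ : ℝ) (n r s : ℕ) (hθ : 0 < θ) :
    inner ℝ (eVec θ n (r + 1)) (eVec θ n (s + 1)) =
      (normQ θ n r)⁻¹ * (normQ θ n s)⁻¹ * form θ n (q θ n r) (q θ n s) := by
  rw [form_eq_sum_weight, mul_sum, PiLp.inner_apply, ← sum_fin_succ]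
  refine sum_congr rfl fun j _ => ?_
  have hj : (j : ℕ) + 1 ∈ Icc 1 n := by rw [mem_Icc]; omega
  have := Real.mul_self_sqrt (weight_pos hθ hj).le
  simp only [eVec, eEntry_eq, RCLike.inner_apply, conj_trivial]
  linear_combination (normQ θ n r)⁻¹ * (normQ θ n s)⁻¹ * q θ n r ((j + 1 : ℕ) : ℝ) *
    q θ n s ((j + 1 : ℕ) : ℝ) * this

theorem orthonormal_eVec {θ : ℝ} (hθ : 0 < θ) (N : ℕ) :
    Orthonormal ℝ (fun r : Fin (N + 1) => eVec θ (N + 1) ((r : ℕ) + 1)) := by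
  rw [orthonormal_iff_ite]
  intro r s
  rw [inner_eVec _ _ _ _ hθ]
  split_ifs with h
  · subst h
    have h1 : normQ θ (N + 1) r * normQ θ (N + 1) r = _ :=
      Real.mul_self_sqrt (form_self_nonneg hθ (N + 1) (q θ (N + 1) r))
    have h2 := (normQ_pos hθ N r).ne'
    rw [← h1]
    field_simp
  · rw [form_q_q_of_ne hθ (by omega) (by omega) (fun e => h (Fin.ext e)), mul_zero]

theorem toEuclideanLin_M_eVec {θ : ℝ} (hθ : 0 < θ) {N r : ℕ} (hr : r ≤ N) :
    Matrix.toEuclideanLin (M θ (N + 1)) (eVec θ (N + 1) (r + 1)) =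
      mu θ (r + 1) • eVec θ (N + 1) (r + 1) := by
  ext i
  have hi : (i : ℕ) + 1 ∈ Icc 1 (N + 1) := by rw [mem_Icc]; omega
  have hw := Real.mul_self_sqrt (weight_pos hθ hi).le
  have hw0 := (Real.sqrt_pos.2 (weight_pos hθ hi)).ne'
  rw [Matrix.toEuclideanLin, Matrix.ofLp_toLpLin, Matrix.toLin'_apply, PiLp.smul_apply, Matrix.mulVec, dotProduct]
  simp only [M, Matrix.of_apply, eVec, smul_eq_mul]
  rw [sum_fin_succ (N + 1) (fun j => mEntry θ (N + 1) (i + 1) j * eEntry θ (N + 1) (r + 1) j)]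
  trans (normQ θ (N + 1) r)⁻¹ / √(weight θ (N + 1) (i + 1)) *
    ∑ j ∈ Icc 1 (N + 1), kernel θ (N + 1) (i + 1) j * q θ (N + 1) r j
  · rw [mul_sum]
    refine sum_congr rfl fun j hj => ?_
    have hj0 := (Real.sqrt_pos.2 (weight_pos hθ hj)).ne'
    rw [mEntry_eq hθ hi hj, eEntry_eq]
    field_simp
  · rw [sum_kernel_mul_q hθ hr _ hi, eEntry_eq]
    nth_rw 2 [← hw]
    field_simp

end Ewens

theorem theorem3 (θ : ℝ) (hθ : 0 < θ) (n : ℕ) (hn : 1 ≤ n) :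
    (∀ r ∈ Finset.Icc 1 n, 0 < Ewens.normQ θ n (r - 1)) ∧
    (∃ b : OrthonormalBasis (Fin n) ℝ (EuclideanSpace ℝ (Fin n)),
      ∀ r : Fin n, b r = Ewens.eVec θ n ((r : ℕ) + 1)) ∧
    (∀ r ∈ Finset.Icc 1 n,
      Module.End.HasEigenvector (Matrix.toEuclideanLin (Ewens.M θ n))
        (Ewens.mu θ r) (Ewens.eVec θ n r)) := by
  obtain ⟨N, rfl⟩ := Nat.exists_eq_add_of_le' hn
  have ho := Ewens.orthonormal_eVec hθ N
  refine ⟨fun r _ => Ewens.normQ_pos hθ N _, ?_, fun r hr => ?_⟩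
  · have hc : Fintype.card (Fin (N + 1)) = Module.finrank ℝ (EuclideanSpace ℝ (Fin (N + 1))) := by
      simp
    have hb := coe_basisOfOrthonormalOfCardEqFinrank ho hc
    refine ⟨(basisOfOrthonormalOfCardEqFinrank ho hc).toOrthonormalBasis (by rwa [hb]),
      fun r => ?_⟩
    rw [Module.Basis.coe_toOrthonormalBasis, hb]
  · rw [Finset.mem_Icc] at hr
    obtain ⟨s, rfl⟩ := Nat.exists_eq_add_of_le' hr.1
    exact ⟨Module.End.mem_eigenspace_iff.2 (Ewens.toEuclideanLin_M_eVec hθ (by omega)),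
      ho.ne_zero ⟨s, by omega⟩⟩
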